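/- **Setting.** Let $\mathbf B$ be the set of bonds (nearest-neighbour edges) of the lattice $\mathbb Z^2$, fix $d\ge 1$, and let $\mathfrak A$ be the quasi-local C*-algebra of the system with observable algebra $M_d(\mathbb C)$ at each bond; for $S\subset\mathbf B$ let $\mathfrak A(S)\subset\mathfrak A$ be the C*-subalgebra generated by the observables at the bonds of $S$. A *cone* is determined by two half-lines in the plane with a common endpoint and an opening angle in $(0,\pi)$; it is identified with the set $\Lambda\subset\mathbf B$ of bonds which, with their endpoints removed, meet the closed area between the half-lines. Complements are taken in $\mathbf B$. Let $\pi_0$ be an irreducible (unital) $*$-representation of $\mathfrak A$ on a Hilbert space $\mathcal H$, and put $\mathcal R(S)=\pi_0(\mathfrak A(S))''$. Assume: * (Haag duality) $\mathcal R(\Lambda)=\mathcal R(\Lambda^c)'$ for every cone $\Lambda$; * (distal split property) $\ll$ is a relation on cones such that $\Lambda_1\ll\Lambda_2$ implies $\Lambda_1\subset\Lambda_2$ and the existence of a Type I factor $\mathcal N$ with $\mathcal R(\Lambda_1)\subset\mathcal N\subset\mathcal R(\Lambda_2)$; * (non-triviality of $\ll$) for each cone $\Lambda_1$ there are a cone $\Lambda_2$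 disjoint from $\Lambda_1$ and a cone $\Lambda$ with $\Lambda_1\ll\Lambda$ and $\Lambda_2\subset\Lambda^c$. An *endomorphism localised in a cone* $\Lambda_1$ is a unital $*$-homomorphism $\rho:\mathfrak A\to\mathcal B(\mathcal H)$ with $\rho(A)=\pi_0(A)$ for $A\in\mathfrak A(\Lambda_1^c)$ which, for every cone $\Lambda\supset\Lambda_1$, extends from $\mathfrak A(\Lambda)$ to a (necessarily unique) normal endomorphism of $\mathcal R(\Lambda)$, again denoted $\rho$ (so that $\rho(\pi_0(A))=\rho(A)$ for $A\in\mathfrak A(\Lambda)$). Such extensions exist automatically if $\rho$ is transportable, that is, if for each cone $\widehat\Lambda$ it is unitarily equivalent to a representation that agrees with $\pi_0$ on $\mathfrak A(\widehat\Lambda^c)$. It is *irreducible* if $\rho(\mathcal R(\Lambda_1))'\cap\mathcal R(\Lambda_1)=\mathbb C I$. **Lemma.** Let $\rho$ be an irreducible endomorphism localised in a cone $\Lambda_1$. Suppose that one of the following holds: 1. $\rho$ acts trivially on $\mathcal R(\Lambda_1)'\cap\mathcal R(\Lambda_2)$ for every cone $\Lambda_2$ with $\Lambda_1\ll\Lambda_2$;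 2. there is a cone $\Lambda_2$ with $\Lambda_1\ll\Lambda_2$ whose opening angle is bigger than that of $\Lambda_1$, and for every such $\Lambda_2$, $\rho$ acts trivially on $\mathcal R(\Lambda_1)'\cap\mathcal R(\Lambda_2)$. Then $\rho$ is inner, in the sense that it is a direct sum of copies of the identity: there is an at most countable family of isometries $V_i\in\mathcal R(\Lambda_1)$ with $V_i^*V_j=\delta_{ij}I$, $\sum_i V_iV_i^*=I$ and $$\rho(A)=\sum_i V_i\,\pi_0(A)\,V_i^*\qquad\text{for all }A\in\mathfrak A,$$ the sums converging in the strong operator topology. -/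

import Mathlib

noncomputable section

namespace SpinSystem

open scoped InnerProductSpace

universe u

/-! ### Bonds and cones -/

/-- The bonds (nearest-neighbour edges) of the square lattice `ℤ²`. The bond with `vertical = false`
joins `(x, y)` to `(x + 1, y)`; the one with `vertical = true` joins `(x, y)` to `(x, y + 1)`. -/
@[ext]
structure Bond where
  x : ℤ
  y : ℤ
  vertical : Bool

/-- A bond as a line segment in the plane `ℂ`, with its two endpoints removed. -/
def Bond.segment (b : Bond) : Set ℂ :=
  {z | ∃ t : ℝ, 0 < t ∧ t < 1 ∧
    z = (b.x : ℂ) + (b.y : ℂ) * Complex.I + (t : ℂ) * (if b.vertical then Complex.I else 1)}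

/-- A (geometric) cone: two half-lines emanating from `apex`, in the directions `direction` and
`direction + angle`, with an opening angle strictly between `0` and `π`. -/
structure Cone where
  apex : ℂ
  direction : ℝ
  angle : ℝ
  angle_pos : 0 < angle
  angle_lt_pi : angle < Real.pi

/-- The area bounded by the two half-lines (which belong to it). -/
def Cone.region (Λ : Cone) : Set ℂ :=
  {z | ∃ r θ : ℝ, 0 ≤ r ∧ Λ.direction ≤ θ ∧ θ ≤ Λ.direction + Λ.angle ∧
    z = Λ.apex + (r : ℂ) * Complex.exp ((θ : ℂ) * Complex.I)}

/-- The set of bonds of a cone: those which, with their endpoints removed, meet its area. -/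
def Cone.bonds (Λ : Cone) : Set Bond :=
  {b | (b.segment ∩ Λ.region).Nonempty}

/-! ### The quasi-local algebra -/

/-- The Hilbert space `ℓ²` over all classical configurations of the bonds, used only to realise
the quasi-local algebra as a concrete C*-algebra. -/
abbrev ConfigSpace (d : ℕ) : Type := lp (fun _ : Bond → Fin d => ℂ) 2

open Classical in
theorem matrixUnit_sum_le {d : ℕ} (b : Bond) (i j : Fin d) (ψ : ConfigSpace d)
    (s : Finset (Bond → Fin d)) :
    ∑ σ ∈ s, ‖(if σ b = i then ψ (Function.update σ b j) else 0 : ℂ)‖ ^ (2 : ENNReal).toReal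
      ≤ ‖ψ‖ ^ (2 : ENNReal).toReal := by
  have h2 : 0 < (2 : ENNReal).toReal := by norm_num
  have h0 : ∀ σ ∈ s, ‖(if σ b = i then ψ (Function.update σ b j) else 0 : ℂ)‖ ^
        (2 : ENNReal).toReal
      = if σ b = i then ‖ψ (Function.update σ b j)‖ ^ (2 : ENNReal).toReal else 0 := by
    intro σ _
    split_ifs <;> simp
  rw [Finset.sum_congr rfl h0, ← Finset.sum_filter]
  have hinj : Set.InjOn (fun σ : Bond → Fin d => Function.update σ b j)
      (s.filter (fun σ => σ b = i)) := by
    intro σ hσ τ hτ h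
    simp only [Finset.coe_filter, Set.mem_ofPred_eq] at hσ hτ
    funext c
    by_cases hc : c = b
    · subst hc
      rw [hσ.2, hτ.2]
    · have := congrFun h c
      simpa [Function.update_of_ne hc] using this
  rw [← Finset.sum_image (f := fun τ => ‖ψ τ‖ ^ (2 : ENNReal).toReal) hinj]
  exact lp.sum_rpow_le_norm_rpow h2 ψ _

open Classical in
/-- The matrix unit `E_{ij} ∈ M_d(ℂ)` placed at the bond `b` (and tensored with the identity at all
other bonds): `(E_{ij} ψ)(σ) = ψ(σ with σ_b replaced by j)` if `σ_b = i`, and `0` otherwise. -/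
def matrixUnit {d : ℕ} (b : Bond) (i j : Fin d) : ConfigSpace d →L[ℂ] ConfigSpace d :=
  LinearMap.mkContinuous
    { toFun := fun ψ =>
        ⟨fun σ => if σ b = i then ψ (Function.update σ b j) else 0,
          memℓp_gen' (matrixUnit_sum_le b i j ψ)⟩
      map_add' := fun ψ φ => by
        ext σ
        change (if σ b = i then (ψ + φ) (Function.update σ b j) else 0) =
          (if σ b = i then ψ (Function.update σ b j) else 0) +
            (if σ b = i then φ (Function.update σ b j) else 0)
        by_cases h : σ b = i <;> simp [h]
      map_smul' := fun c ψ => by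
        ext σ
        by_cases h : σ b = i <;> simp [h] }
    1 (fun ψ => by
      rw [one_mul]
      exact lp.norm_le_of_forall_sum_le (by norm_num) (norm_nonneg _) (matrixUnit_sum_le b i j ψ))

open Classical in
theorem matrixUnit_apply {d : ℕ} (b : Bond) (i j : Fin d) (ψ : ConfigSpace d) (σ : Bond → Fin d) :
    matrixUnit b i j ψ σ = if σ b = i then ψ (Function.update σ b j) else 0 := rfl

theorem matrixUnit_commute {d : ℕ} {b c : Bond} (h : b ≠ c) (i j k l : Fin d) :
    Commute (matrixUnit b i j) (matrixUnit c k l) := by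
  classical
  ext ψ σ
  change matrixUnit b i j (matrixUnit c k l ψ) σ = matrixUnit c k l (matrixUnit b i j ψ) σ
  simp only [matrixUnit_apply, Function.update_of_ne h, Function.update_of_ne h.symm]
  rw [Function.update_comm h]
  split_ifs <;> rfl

theorem star_matrixUnit {d : ℕ} (b : Bond) (i j : Fin d) :
    star (matrixUnit b i j) = matrixUnit b j i := by
  classical
  rw [ContinuousLinearMap.star_eq_adjoint, eq_comm, ContinuousLinearMap.eq_adjoint_iff]
  intro ψ φ
  rw [lp.inner_eq_tsum, lp.inner_eq_tsum]
  have hinv : Function.Involutive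
      (fun σ : Bond → Fin d => Function.update σ b (Equiv.swap i j (σ b))) := by
    intro σ
    simp
  rw [← (hinv.toPerm _).tsum_eq]
  refine tsum_congr fun σ => ?_
  simp only [Function.Involutive.coe_toPerm, matrixUnit_apply, Function.update_self,
    Function.update_idem]
  by_cases h : σ b = i
  · have h' : Function.update σ b i = σ := by rw [← h, Function.update_eq_self]
    simp [h, h']
  · have h' : Equiv.swap i j (σ b) ≠ j := by
      intro h2
      apply h
      have := congrArg (Equiv.swap i j) h2
      simpa using this
    simp [h, h']

/-- The algebra `𝔄(S)` of observables localised in a set `S` of bonds, for a system with a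
`d`-dimensional Hilbert space at every bond: the norm closure of the *-algebra generated by the
copies of `M_d(ℂ)` at the bonds of `S`. For finite `S` this is `⊗_{b ∈ S} M_d(ℂ)`, and in general
it is the norm closure of the union of the algebras of the finite subsets of `S`. -/
def localAlgebra (d : ℕ) (S : Set Bond) :
    StarSubalgebra ℂ (ConfigSpace d →L[ℂ] ConfigSpace d) :=
  (StarAlgebra.adjoin ℂ {E | ∃ b ∈ S, ∃ i j : Fin d, E = matrixUnit b i j}).topologicalClosure

theorem localAlgebra_mono (d : ℕ) {S T : Set Bond} (h : S ⊆ T) :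
    localAlgebra d S ≤ localAlgebra d T := by
  apply StarSubalgebra.topologicalClosure_mono
  apply StarAlgebra.adjoin_mono
  rintro E ⟨b, hb, i, j, rfl⟩
  exact ⟨b, h hb, i, j, rfl⟩

/-- Locality: observables in disjoint regions commute. -/
theorem localAlgebra_commute {d : ℕ} {S T : Set Bond} (hST : Disjoint S T)
    {A B : ConfigSpace d →L[ℂ] ConfigSpace d} (hA : A ∈ localAlgebra d S)
    (hB : B ∈ localAlgebra d T) : A * B = B * A := by
  have key : ∀ (s : Set (ConfigSpace d →L[ℂ] ConfigSpace d)) (C : _),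
      (∀ E ∈ s, E * C = C * E ∧ star E * C = C * star E) →
      ∀ A ∈ (StarAlgebra.adjoin ℂ s).topologicalClosure, A * C = C * A := by
    intro s C hC A hA
    have h1 : StarAlgebra.adjoin ℂ s ≤ StarSubalgebra.centralizer ℂ {C} := by
      rw [StarAlgebra.adjoin_le_iff]
      intro E hE
      rw [SetLike.mem_coe, StarSubalgebra.mem_centralizer_iff]
      rintro g rfl
      refine ⟨(hC E hE).1.symm, ?_⟩
      have := congrArg star (hC E hE).2
      simpa using this
    have h2 : IsClosed {X : ConfigSpace d →L[ℂ] ConfigSpace d | X * C = C * X} :=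
      isClosed_eq (by fun_prop) (by fun_prop)
    refine closure_minimal (fun X hX => ?_) h2 hA
    have := (StarSubalgebra.mem_centralizer_iff ℂ).1 (h1 hX) C rfl
    exact this.1.symm
  refine key _ B ?_ A hA
  rintro E ⟨b, hb, i, j, rfl⟩
  have h3 : ∀ i j : Fin d, matrixUnit b i j * B = B * matrixUnit b i j := by
    intro i j
    refine (key _ _ ?_ B hB).symm
    rintro F ⟨c, hc, k, l, rfl⟩
    have hcb : c ≠ b := fun h => Set.disjoint_left.1 hST hb (h ▸ hc)
    rw [star_matrixUnit]
    exact ⟨matrixUnit_commute hcb _ _ _ _, matrixUnit_commute hcb _ _ _ _⟩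
  rw [star_matrixUnit]
  exact ⟨h3 i j, h3 j i⟩

/-- The quasi-local algebra `𝔄 = 𝔄(all bonds)`. -/
abbrev QuasiLocal (d : ℕ) : Type := localAlgebra d Set.univ

/-- `𝔄(S)` as a set of elements of the quasi-local algebra. -/
def observables (d : ℕ) (S : Set Bond) : Set (QuasiLocal d) :=
  {a | (a : ConfigSpace d →L[ℂ] ConfigSpace d) ∈ localAlgebra d S}

/-! ### The von Neumann algebras of regions -/

section

variable {H : Type u} [NormedAddCommGroup H] [InnerProductSpace ℂ H] [CompleteSpace H]

/-- The von Neumann algebra generated by a set of operators, i.e. the double commutant of the set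
together with its adjoints. -/
def generatedVN (s : Set (H →L[ℂ] H)) : VonNeumannAlgebra H where
  toStarSubalgebra := StarSubalgebra.centralizer ℂ
    (StarSubalgebra.centralizer ℂ s : Set (H →L[ℂ] H))
  centralizer_centralizer' := by
    change Set.centralizer (Set.centralizer
      (StarSubalgebra.centralizer ℂ (StarSubalgebra.centralizer ℂ s : Set (H →L[ℂ] H)) :
        Set (H →L[ℂ] H))) =
      (StarSubalgebra.centralizer ℂ (StarSubalgebra.centralizer ℂ s : Set (H →L[ℂ] H)) :
        Set (H →L[ℂ] H))
    rw [StarSubalgebra.coe_centralizer_centralizer, Set.centralizer_centralizer_centralizer]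

variable {d : ℕ}

/-- `R(S) = π₀(𝔄(S))''`. -/
def regionVN (π₀ : QuasiLocal d →⋆ₐ[ℂ] (H →L[ℂ] H)) (S : Set Bond) : VonNeumannAlgebra H :=
  generatedVN (π₀ '' observables d S)

/-- A representation is irreducible if it acts on a nonzero space and only the scalars commute with
all represented observables. -/
def IsIrreducibleRep (π₀ : QuasiLocal d →⋆ₐ[ℂ] (H →L[ℂ] H)) : Prop :=
  Nontrivial H ∧ ∀ T : H →L[ℂ] H, (∀ a, T * π₀ a = π₀ a * T) → ∃ c : ℂ, T = c • 1

/-- Haag duality for cones: `R(Λ) = R(Λᶜ)'` for every cone `Λ`. -/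
def HaagDuality (π₀ : QuasiLocal d →⋆ₐ[ℂ] (H →L[ℂ] H)) : Prop :=
  ∀ Λ : Cone, regionVN π₀ Λ.bonds = (regionVN π₀ Λ.bondsᶜ).commutant

/-- A Type I factor: a von Neumann algebra that is *-isomorphic to the algebra of all bounded
operators on some Hilbert space. -/
def IsTypeIFactor (N : VonNeumannAlgebra H) : Prop :=
  ∃ (K : Type u) (_ : NormedAddCommGroup K) (_ : InnerProductSpace ℂ K) (_ : CompleteSpace K),
    Nonempty (N.toStarSubalgebra ≃⋆ₐ[ℂ] (K →L[ℂ] K))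

/-- The relation `ll` on cones witnesses the distal split property of `π₀`. -/
def IsDistalSplit (π₀ : QuasiLocal d →⋆ₐ[ℂ] (H →L[ℂ] H)) (ll : Cone → Cone → Prop) : Prop :=
  ∀ Λ₁ Λ₂ : Cone, ll Λ₁ Λ₂ → Λ₁.bonds ⊆ Λ₂.bonds ∧
    ∃ N : VonNeumannAlgebra H, IsTypeIFactor N ∧
      regionVN π₀ Λ₁.bonds ≤ N ∧ N ≤ regionVN π₀ Λ₂.bonds

/-- Non-triviality of the relation `ll`: for every cone `Λ₁` there are a cone `Λ₂` disjoint from it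
and a cone `Λ` with `Λ₁ ≪ Λ` and `Λ₂ ⊆ Λᶜ`. -/
def SeparatesCones (ll : Cone → Cone → Prop) : Prop :=
  ∀ Λ₁ : Cone, ∃ Λ₂ Λ : Cone, Disjoint Λ₁.bonds Λ₂.bonds ∧ ll Λ₁ Λ ∧ Λ₂.bonds ⊆ Λ.bondsᶜ

/-! ### Localised endomorphisms -/

/-- A linear map from a von Neumann algebra into `B(H)` is normal (σ-weakly continuous) if
all its matrix coefficients are of the form `x ↦ ∑ₙ ⟨uₙ, x vₙ⟩` with square-summable sequences
of vectors `u`, `v`. -/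
def IsNormalMap (M : VonNeumannAlgebra H) (φ : M.toStarSubalgebra → (H →L[ℂ] H)) : Prop :=
  ∀ ξ η : H, ∃ u v : ℕ → H, Summable (fun n => ‖u n‖ ^ 2) ∧ Summable (fun n => ‖v n‖ ^ 2) ∧
    ∀ x : M.toStarSubalgebra,
      HasSum (fun n => ⟪u n, (x : H →L[ℂ] H) (v n)⟫_ℂ) ⟪ξ, φ x η⟫_ℂ

/-- The endomorphism `φ` of `R(S)` is the normal extension of `ρ` from `𝔄(S)` to `R(S)`.
(There is at most one, as `π₀(𝔄(S))` is σ-weakly dense in `R(S)`.) -/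
structure IsNormalExtension (π₀ ρ : QuasiLocal d →⋆ₐ[ℂ] (H →L[ℂ] H)) (S : Set Bond)
    (φ : (regionVN π₀ S).toStarSubalgebra →⋆ₐ[ℂ] (regionVN π₀ S).toStarSubalgebra) : Prop where
  map_eq : ∀ a ∈ observables d S, ∀ x : (regionVN π₀ S).toStarSubalgebra,
    (x : H →L[ℂ] H) = π₀ a → (φ x : H →L[ℂ] H) = ρ a
  normal : IsNormalMap (regionVN π₀ S) (fun x => (φ x : H →L[ℂ] H))

/-- `ρ` acts like `π₀` on the observables outside `Λ`. -/
def IsLocalisedIn (π₀ ρ : QuasiLocal d →⋆ₐ[ℂ] (H →L[ℂ] H)) (Λ : Cone) : Prop :=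
  ∀ a ∈ observables d Λ.bondsᶜ, ρ a = π₀ a

/-- `ρ` is an endomorphism localised in the cone `Λ`: it acts trivially on the observables outside
`Λ`, and extends to a (normal) endomorphism of `R(Λ')` for every cone `Λ' ⊇ Λ`. The extension
exists automatically, by Haag duality, if `ρ` is transportable: see `IsTransportable.isLocalisedEndomorphism`. -/
structure IsLocalisedEndomorphism (π₀ : QuasiLocal d →⋆ₐ[ℂ] (H →L[ℂ] H)) (Λ : Cone)
    (ρ : QuasiLocal d →⋆ₐ[ℂ] (H →L[ℂ] H)) : Prop where
  localised : IsLocalisedIn π₀ ρ Λ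
  extends_to : ∀ Λ' : Cone, Λ.bonds ⊆ Λ'.bonds → ∃ φ, IsNormalExtension π₀ ρ Λ'.bonds φ

/-- `ρ(R(Λ))' ∩ R(Λ) = ℂ 1`, where `ρ` is extended to `R(Λ)`. -/
def IsIrreducibleOn (π₀ : QuasiLocal d →⋆ₐ[ℂ] (H →L[ℂ] H)) (Λ : Cone)
    (ρ : QuasiLocal d →⋆ₐ[ℂ] (H →L[ℂ] H)) : Prop :=
  ∀ φ, IsNormalExtension π₀ ρ Λ.bonds φ →
    ∀ T ∈ regionVN π₀ Λ.bonds,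
      (∀ x, T * (φ x : H →L[ℂ] H) = (φ x : H →L[ℂ] H) * T) → ∃ c : ℂ, T = c • 1

/-- `ρ`, extended to `R(Λ₂)`, acts trivially on the relative commutant `R(Λ₁)' ∩ R(Λ₂)`. -/
def ActsTriviallyOnRelativeCommutant (π₀ : QuasiLocal d →⋆ₐ[ℂ] (H →L[ℂ] H)) (Λ₁ Λ₂ : Cone)
    (ρ : QuasiLocal d →⋆ₐ[ℂ] (H →L[ℂ] H)) : Prop :=
  ∀ φ, IsNormalExtension π₀ ρ Λ₂.bonds φ →
    ∀ x : (regionVN π₀ Λ₂.bonds).toStarSubalgebra,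
      (x : H →L[ℂ] H) ∈ (regionVN π₀ Λ₁.bonds).commutant → φ x = x

/-- `ρ` is a direct sum of (at most countably many) copies of the identity endomorphism: there are
isometries `V i ∈ R(Λ)` with `V i* V j = δ_{ij}`, `∑ V i V i* = 1` and
`ρ(A) = ∑ V i π₀(A) V i*`, the sums converging in the strong operator topology. -/
def IsSumOfIdentities (π₀ : QuasiLocal d →⋆ₐ[ℂ] (H →L[ℂ] H)) (Λ : Cone)
    (ρ : QuasiLocal d →⋆ₐ[ℂ] (H →L[ℂ] H)) : Prop :=
  ∃ (ι : Type) (_ : Countable ι) (V : ι → (H →L[ℂ] H)),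
    (∀ i, V i ∈ regionVN π₀ Λ.bonds) ∧
    (∀ i, star (V i) * V i = 1) ∧
    (∀ i j, i ≠ j → star (V i) * V j = 0) ∧
    (∀ ψ : H, HasSum (fun i => (V i * star (V i)) ψ) ψ) ∧
    ∀ (a : QuasiLocal d) (ψ : H), HasSum (fun i => (V i * π₀ a * star (V i)) ψ) (ρ a ψ)

/-- `ρ` is transportable: for every cone `Λ` it is unitarily equivalent to some `σ` that
is localised in `Λ`. -/
def IsTransportable (π₀ ρ : QuasiLocal d →⋆ₐ[ℂ] (H →L[ℂ] H)) : Prop :=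
  ∀ Λ : Cone, ∃ σ : QuasiLocal d →⋆ₐ[ℂ] (H →L[ℂ] H), IsLocalisedIn π₀ σ Λ ∧
    ∃ V ∈ unitary (H →L[ℂ] H), ∀ a, ρ a = V * σ a * star V

theorem mem_generatedVN {s : Set (H →L[ℂ] H)} {x : H →L[ℂ] H} :
    x ∈ generatedVN s ↔
      ∀ y : H →L[ℂ] H, (∀ g ∈ s, g * y = y * g ∧ star g * y = y * star g) → y * x = x * y := by
  change x ∈ StarSubalgebra.centralizer ℂ (StarSubalgebra.centralizer ℂ s : Set (H →L[ℂ] H)) ↔ _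
  rw [StarSubalgebra.mem_centralizer_iff]
  constructor
  · intro h y hy
    exact (h y ((StarSubalgebra.mem_centralizer_iff ℂ).2 hy)).1
  · intro h y hy
    exact ⟨h y ((StarSubalgebra.mem_centralizer_iff ℂ).1 hy),
      h _ ((StarSubalgebra.mem_centralizer_iff ℂ).1 (star_mem hy))⟩

theorem star_mem_observables {S : Set Bond} {a : QuasiLocal d} (ha : a ∈ observables d S) :
    star a ∈ observables d S :=
  star_mem (S := StarSubalgebra ℂ (ConfigSpace d →L[ℂ] ConfigSpace d)) (s := localAlgebra d S) ha

/-- Localised and transportable representations are localised endomorphisms: Haag duality provides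
the extensions to the cone algebras. -/
theorem IsTransportable.isLocalisedEndomorphism
    {π₀ ρ : QuasiLocal d →⋆ₐ[ℂ] (H →L[ℂ] H)} {Λ : Cone} (hHaag : HaagDuality π₀)
    (hdisj : ∀ Λ₁ : Cone, ∃ Λ₂ : Cone, Disjoint Λ₁.bonds Λ₂.bonds)
    (hloc : IsLocalisedIn π₀ ρ Λ) (htr : IsTransportable π₀ ρ) :
    IsLocalisedEndomorphism π₀ Λ ρ := by
  refine ⟨hloc, fun Λ' hΛ' => ?_⟩
  obtain ⟨Λ'', hΛ''⟩ := hdisj Λ'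
  obtain ⟨σ, hσ, V, hV, hρ⟩ := htr Λ''
  have hV1 : star V * V = 1 := (Unitary.mem_iff.1 hV).1
  have hV2 : V * star V = 1 := (Unitary.mem_iff.1 hV).2
  have hVV : ∀ X : H →L[ℂ] H, star V * (V * X) = X := fun X => by
    rw [← mul_assoc, hV1, one_mul]
  have hVV' : ∀ X : H →L[ℂ] H, V * (star V * X) = X := fun X => by
    rw [← mul_assoc, hV2, one_mul]
  have hρ' : ∀ a ∈ observables d Λ'.bonds, ρ a = V * π₀ a * star V := by
    intro a ha
    rw [hρ a, hσ a (localAlgebra_mono d hΛ''.subset_compl_right ha)]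
  have hmem : ∀ x ∈ regionVN π₀ Λ'.bonds, V * x * star V ∈ regionVN π₀ Λ'.bonds := by
    intro x hx
    have h1 : ∀ b ∈ observables d Λ'.bondsᶜ, π₀ b * (V * x * star V) = V * x * star V * π₀ b := by
      intro b hb
      have hb' : ρ b = π₀ b := hloc b (localAlgebra_mono d (Set.compl_subset_compl.2 hΛ') hb)
      have h2 : ∀ a ∈ observables d Λ'.bonds,
          π₀ a * (star V * π₀ b * V) = star V * π₀ b * V * π₀ a := by
        intro a ha
        have hab : a * b = b * a := Subtype.ext
          (localAlgebra_commute (disjoint_compl_right (a := Λ'.bonds)) ha hb)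
        have h3 : V * π₀ a * star V * π₀ b = π₀ b * (V * π₀ a * star V) := by
          rw [← hρ' a ha, ← hb', ← map_mul, ← map_mul, hab]
        have h4 := congrArg (fun X => star V * X * V) h3
        simpa only [mul_assoc, hVV, hV1, mul_one] using h4
      have h5 := mem_generatedVN.1 hx (star V * π₀ b * V) (by
        rintro _ ⟨a, ha, rfl⟩
        refine ⟨h2 a ha, ?_⟩
        rw [← map_star]
        exact h2 _ (star_mem_observables ha))
      have h6 := congrArg (fun X => V * X * star V) h5
      simpa only [mul_assoc, hVV', hV2, mul_one] using h6
    rw [hHaag Λ', VonNeumannAlgebra.mem_commutant_iff]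
    intro g hg
    refine (mem_generatedVN.1 hg (V * x * star V) ?_).symm
    rintro _ ⟨b, hb, rfl⟩
    refine ⟨h1 b hb, ?_⟩
    rw [← map_star]
    exact h1 _ (star_mem_observables hb)
  let φ : (regionVN π₀ Λ'.bonds).toStarSubalgebra →⋆ₐ[ℂ]
      (regionVN π₀ Λ'.bonds).toStarSubalgebra :=
    { toFun := fun x => ⟨V * x * star V, hmem x x.2⟩
      map_one' := Subtype.ext (by simp [hV2])
      map_mul' := fun x y => Subtype.ext (by simp [mul_assoc, hVV])
      map_zero' := Subtype.ext (by simp)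
      map_add' := fun x y => Subtype.ext (by simp [mul_add, add_mul])
      commutes' := fun c => Subtype.ext (by
        simp [Algebra.algebraMap_eq_smul_one, hV2])
      map_star' := fun x => Subtype.ext (by simp [mul_assoc]) }
  refine ⟨φ, ?_, ?_⟩
  · intro a ha x hx
    change V * (x : H →L[ℂ] H) * star V = ρ a
    rw [hx, hρ' a ha]
  · intro ξ η
    refine ⟨Pi.single 0 (star V ξ), Pi.single 0 (star V η), ?_, ?_, ?_⟩
    · exact summable_of_ne_finset_zero (s := {0}) fun n hn => by simp_all
    · exact summable_of_ne_finset_zero (s := {0}) fun n hn => by simp_all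
    · intro x
      have : ⟪ξ, (φ x : H →L[ℂ] H) η⟫_ℂ = ⟪star V ξ, (x : H →L[ℂ] H) (star V η)⟫_ℂ := by
        change ⟪ξ, V ((x : H →L[ℂ] H) (star V η))⟫_ℂ = _
        rw [ContinuousLinearMap.star_eq_adjoint, ContinuousLinearMap.adjoint_inner_left]
      rw [this]
      convert hasSum_single (f := fun n : ℕ => ⟪(Pi.single 0 (star V ξ) : ℕ → H) n,
        (x : H →L[ℂ] H) ((Pi.single 0 (star V η) : ℕ → H) n)⟫_ℂ) 0 ?_ using 1
      · simp
      · intro n hn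
        simp [hn]

end

end SpinSystem

end

/-! Let `N` be a Type I factor between `R(Λ₁)` and `R = R(Λ₂)`. Since `N' ⊆ R(Λ₁)'`, the extension
`φ` of `ρ` to `R` fixes `N' ∩ R`. As `R` is generated by `N` and `N' ∩ R`, like a tensor product,
only the images `F i j = φ(E i j)` of minimal matrix units of `N` matter. Two systems of matrix
units are intertwined by `V = ∑ F j o * w * E o j` for any `w` from the corner of `E o o` to that of
`F o o`. With `w = F o o * E i o`, which commutes with `N' ∩ R`, this `V` also intertwines the
identity and `φ` on all of `R`: `exists_intertwiner_of_trivial_on_relative_commutant`.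

`V` commutes with `R'` too, so it intertwines `π₀` and `ρ` everywhere, and Haag duality puts it in
`R(Λ₁)`. Irreducibility of `π₀` makes `V* V` scalar and irreducibility of `ρ` makes `V V*` scalar. A
multiple of `V` is therefore unitary, and a single copy of the identity suffices.

Normality enters twice: it keeps the system `F` total (`IsMatrixUnits.isTotal_map`), and it carries
intertwining from `𝔄(S)` to `R(S)` (`IsNormalExtension.intertwines`). -/

noncomputable section

namespace SpinSystem

open scoped InnerProductSpace

universe u

/-! ### Matrix units over an arbitrary index set and their intertwiners. -/

section MatrixUnits

variable {H : Type*} [NormedAddCommGroup H] [InnerProductSpace ℂ H]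
variable {ι : Type*}

/-- The diagonal matrix units have no common kernel. -/
def IsTotal (E : ι → ι → (H →L[ℂ] H)) : Prop :=
  ∀ ψ : H, (∀ i, E i i ψ = 0) → ψ = 0

/-- A square-summable column of operators is a bounded operator into `ℓ²(ι, H)`. -/
theorem exists_column (T : ι → (H →L[ℂ] H)) (C : ℝ) (hC : 0 ≤ C)
    (hT : ∀ (ψ : H) (s : Finset ι), ∑ i ∈ s, ‖T i ψ‖ ^ 2 ≤ (C * ‖ψ‖) ^ 2) :
    ∃ S : H →L[ℂ] lp (fun _ : ι => H) 2, ∀ ψ i, S ψ i = T i ψ := by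
  have hT' : ∀ (ψ : H) (s : Finset ι),
      ∑ i ∈ s, ‖T i ψ‖ ^ (2 : ENNReal).toReal ≤ (C * ‖ψ‖) ^ (2 : ENNReal).toReal := by
    intro ψ s
    simpa using hT ψ s
  refine ⟨LinearMap.mkContinuous
    { toFun := fun ψ => ⟨fun i => T i ψ, memℓp_gen' (hT' ψ)⟩
      map_add' := fun ψ φ => by
        ext i
        exact map_add (T i) ψ φ
      map_smul' := fun c ψ => by
        ext i
        exact map_smul (T i) c ψ } C (fun ψ => ?_), fun ψ i => rfl⟩
  exact lp.norm_le_of_forall_sum_le (by norm_num) (by positivity) (hT' ψ)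

variable [CompleteSpace H]

/-- The projection onto an invariant subspace of `T` and `T*` commutes with `T`. -/
theorem starProjection_apply_comm {K : Submodule ℂ H} [K.HasOrthogonalProjection]
    {T : H →L[ℂ] H} (hT : ∀ f ∈ K, T f ∈ K) (hT' : ∀ f ∈ K, star T f ∈ K) (f : H) :
    K.starProjection (T f) = T (K.starProjection f) := by
  refine Submodule.eq_starProjection_of_mem_orthogonal (hT _ (K.starProjection_apply_mem f)) ?_
  rw [← map_sub, Submodule.mem_orthogonal]
  intro g hg
  rw [← ContinuousLinearMap.adjoint_inner_left, ← ContinuousLinearMap.star_eq_adjoint]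
  exact (Submodule.mem_orthogonal _ _).1 (K.sub_starProjection_mem_orthogonal f) _ (hT' g hg)

/-- A system of matrix units, indexed by an arbitrary set. -/
structure IsMatrixUnits (E : ι → ι → (H →L[ℂ] H)) : Prop where
  mul_same : ∀ i j k, E i j * E j k = E i k
  mul_of_ne : ∀ i {j k} l, j ≠ k → E i j * E k l = 0
  star_eq : ∀ i j, star (E i j) = E j i

namespace IsMatrixUnits

variable {E F : ι → ι → (H →L[ℂ] H)}

/-- Bessel's inequality: `‖E o i ψ‖² = ⟪ψ, E i i ψ⟫`, and finite sums of the `E i i` are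
projections. -/
theorem sum_norm_sq_le (hE : IsMatrixUnits E) (o : ι) (ψ : H) (s : Finset ι) :
    ∑ i ∈ s, ‖E o i ψ‖ ^ 2 ≤ ‖ψ‖ ^ 2 := by
  classical
  set p : H →L[ℂ] H := ∑ i ∈ s, E i i with hp
  have hpp : p * p = p := by
    rw [hp, Finset.sum_mul_sum]
    refine Finset.sum_congr rfl fun i hi => ?_
    rw [Finset.sum_eq_single_of_mem i hi fun j _ hj => hE.mul_of_ne _ _ hj.symm, hE.mul_same]
  have hps : star p = p := by
    simp [hp, star_sum, hE.star_eq]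
  have hi : ∀ i, ((‖E o i ψ‖ ^ 2 : ℝ) : ℂ) = ⟪ψ, E i i ψ⟫_ℂ := by
    intro i
    rw [← hE.mul_same i o i, ← hE.star_eq o i, mul_apply_eq_comp,
      ContinuousLinearMap.star_eq_adjoint, ContinuousLinearMap.adjoint_inner_right,
      inner_self_eq_norm_sq_to_K]
    norm_cast
  have h1 : ((∑ i ∈ s, ‖E o i ψ‖ ^ 2 : ℝ) : ℂ) = ⟪ψ, p ψ⟫_ℂ := by
    rw [Complex.ofReal_sum, hp, _root_.sum_apply, inner_sum]
    exact Finset.sum_congr rfl fun i _ => hi i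
  have h2 : ⟪ψ, p ψ⟫_ℂ = ((‖p ψ‖ ^ 2 : ℝ) : ℂ) := by
    conv_lhs => rw [← hpp]
    rw [mul_apply_eq_comp, ← hps, ContinuousLinearMap.star_eq_adjoint,
      ContinuousLinearMap.adjoint_inner_right, ← ContinuousLinearMap.star_eq_adjoint, hps,
      inner_self_eq_norm_sq_to_K]
    norm_cast
  have h3 : ∑ i ∈ s, ‖E o i ψ‖ ^ 2 = ‖p ψ‖ ^ 2 := by
    rw [h2] at h1
    exact_mod_cast h1
  have h4 : ‖p ψ‖ ^ 2 ≤ ‖ψ‖ * ‖p ψ‖ := by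
    have := norm_inner_le_norm (𝕜 := ℂ) ψ (p ψ)
    rw [h2, Complex.norm_real, Real.norm_of_nonneg (by positivity)] at this
    exact this
  rw [h3]
  have h5 : ‖p ψ‖ ≤ ‖ψ‖ := by
    by_contra! h
    nlinarith [norm_nonneg ψ]
  gcongr

/-- Multiplying by `E i o` on the left recovers `E i i`, and the `E i i` have no common kernel.
Operator identities can thus be checked row by row, without infinite sums. -/
theorem eq_of_forall_mul (hE : IsMatrixUnits E) (ht : IsTotal E) (o : ι) {A B : H →L[ℂ] H}
    (h : ∀ j, E o j * A = E o j * B) : A = B := by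
  ext ψ
  rw [← sub_eq_zero]
  refine ht _ fun i => ?_
  have := congrArg (fun X => (E i o * X) ψ) (h i)
  simp only [← mul_assoc, hE.mul_same] at this
  rw [map_sub, sub_eq_zero]
  exact this

theorem eq_of_forall_mul_right (hE : IsMatrixUnits E) (ht : IsTotal E) (o : ι) {A B : H →L[ℂ] H}
    (h : ∀ i, A * E i o = B * E i o) : A = B := by
  refine star_injective (hE.eq_of_forall_mul ht o fun j => ?_)
  have := congrArg star (h j)
  simpa [hE.star_eq] using this

/-- An operator between the corners of two systems of matrix units extends to an
operator intertwining the two systems. -/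
theorem exists_intertwiner (hF : IsMatrixUnits F) (hE : IsMatrixUnits E) (o : ι)
    {w : H →L[ℂ] H} (hw : F o o * w = w) : ∃ V : H →L[ℂ] H, ∀ j, F o j * V = w * E o j := by
  obtain ⟨S, hS⟩ := exists_column (F o) 1 zero_le_one fun ψ s => by
    simpa using hF.sum_norm_sq_le o ψ s
  obtain ⟨R, hR⟩ := exists_column (fun i => w * E o i) ‖w‖ (norm_nonneg _) fun ψ s => by
    rw [mul_pow]
    refine le_trans ?_ (mul_le_mul_of_nonneg_left (hE.sum_norm_sq_le o ψ s) (sq_nonneg ‖w‖))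
    rw [Finset.mul_sum]
    refine Finset.sum_le_sum fun i _ => ?_
    rw [← mul_pow]
    gcongr
    exact w.le_opNorm _
  -- With columns `S = (F o j)` and `R = (w * E o j)`, the product `S* R` gives a meaning to `∑ F j
  -- o * w * E o j`; the Bessel bounds make both columns bounded.
  refine ⟨ContinuousLinearMap.adjoint S ∘L R, fun j => ?_⟩
  ext ψ
  refine ext_inner_left ℂ fun η => ?_
  have h1 : ⟪η, (F o j * (ContinuousLinearMap.adjoint S ∘L R)) ψ⟫_ℂ = ⟪S (F j o η), R ψ⟫_ℂ := by
    rw [mul_apply_eq_comp, ← hF.star_eq j o, ContinuousLinearMap.star_eq_adjoint,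
      ContinuousLinearMap.adjoint_inner_right, ContinuousLinearMap.comp_apply,
      ContinuousLinearMap.adjoint_inner_right]
  rw [h1, lp.inner_eq_tsum, tsum_eq_single j]
  · rw [hS, hR, ← mul_apply_eq_comp, hF.mul_same,
      ← ContinuousLinearMap.adjoint_inner_right, ← ContinuousLinearMap.star_eq_adjoint, hF.star_eq,
      ← mul_apply_eq_comp, ← mul_assoc, hw]
  · intro i hi
    rw [hS, ← mul_apply_eq_comp, hF.mul_of_ne _ _ hi]
    simp

theorem intertwiner_mul (hF : IsMatrixUnits F) (hFt : IsTotal F) (hE : IsMatrixUnits E) {o : ι}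
    {w V : H →L[ℂ] H} (hw : F o o * w = w) (hw' : w * E o o = w)
    (hV : ∀ j, F o j * V = w * E o j) (i : ι) : V * E i o = F i o * w := by
  refine hF.eq_of_forall_mul hFt o fun j => ?_
  rw [← mul_assoc, hV, ← mul_assoc, mul_assoc]
  by_cases h : j = i
  · subst h
    rw [hE.mul_same, hF.mul_same, hw, hw']
  · rw [hE.mul_of_ne _ _ h, hF.mul_of_ne _ _ h, mul_zero, zero_mul]

/-- The diagonal matrix units of a total system sum to the identity, weakly. -/
theorem hasSum_inner (hE : IsMatrixUnits E) (ht : IsTotal E) (o : ι) (η ψ : H) :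
    HasSum (fun i => ⟪η, E i i ψ⟫_ℂ) ⟪η, ψ⟫_ℂ := by
  obtain ⟨S, hS⟩ := exists_column (E o) 1 zero_le_one fun ψ s => by
    simpa using hE.sum_norm_sq_le o ψ s
  have h0 : ∀ (η : H) (T : lp (fun _ : ι => H) 2),
      HasSum (fun i => ⟪η, E i o (T i)⟫_ℂ) ⟪η, ContinuousLinearMap.adjoint S T⟫_ℂ := by
    intro η T
    rw [ContinuousLinearMap.adjoint_inner_right]
    refine (lp.hasSum_inner (𝕜 := ℂ) (S η) T).congr_fun fun i => ?_
    rw [hS, ← hE.star_eq o i, ContinuousLinearMap.star_eq_adjoint,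
      ContinuousLinearMap.adjoint_inner_right]
  -- Totality makes the column `S = (E o i)` an isometry; expanding `S* S` weakly gives the sum of
  -- the `E i i`.
  have h1 : ContinuousLinearMap.adjoint S ∘L S = 1 := by
    refine hE.eq_of_forall_mul ht o fun j => ?_
    ext ψ
    refine ext_inner_left ℂ fun ξ => ?_
    rw [mul_apply_eq_comp, ← hE.star_eq j o, ContinuousLinearMap.star_eq_adjoint,
      ContinuousLinearMap.adjoint_inner_right, ContinuousLinearMap.comp_apply]
    refine (h0 _ _).unique ?_
    convert hasSum_single (f := fun i => ⟪E j o ξ, E i o (S ψ i)⟫_ℂ) j ?_ using 1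
    · rw [hS, ← ContinuousLinearMap.adjoint_inner_right, ← ContinuousLinearMap.star_eq_adjoint,
        hE.star_eq, ← mul_apply_eq_comp, ← mul_apply_eq_comp,
        hE.mul_same, hE.mul_same, mul_one]
    · intro i hi
      rw [← ContinuousLinearMap.adjoint_inner_right, ← ContinuousLinearMap.star_eq_adjoint,
        hE.star_eq, ← mul_apply_eq_comp, hE.mul_of_ne _ _ hi.symm]
      simp
  have h2 := h0 η (S ψ)
  rw [← ContinuousLinearMap.comp_apply, h1, one_apply_eq_self] at h2
  refine h2.congr_fun fun i => ?_
  rw [hS, ← mul_apply_eq_comp, hE.mul_same]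

end IsMatrixUnits

end MatrixUnits

/-! ### Consequences of normality: totality of images and vanishing on double commutants. -/

section Normal

variable {H : Type u} [NormedAddCommGroup H] [InnerProductSpace ℂ H] [CompleteSpace H]
variable {ι : Type*}

theorem IsMatrixUnits.map {M : VonNeumannAlgebra H}
    (φ : M.toStarSubalgebra →⋆ₐ[ℂ] (H →L[ℂ] H)) {E : ι → ι → M.toStarSubalgebra}
    (hE : IsMatrixUnits fun i j => (E i j : H →L[ℂ] H)) : IsMatrixUnits fun i j => φ (E i j) where
  mul_same i j k := by
    rw [← map_mul]
    exact congrArg φ (Subtype.ext (hE.mul_same i j k))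
  mul_of_ne i j k l h := by
    rw [← map_mul, ← map_zero φ]
    exact congrArg φ (Subtype.ext (hE.mul_of_ne i l h))
  star_eq i j := by
    rw [← map_star]
    exact congrArg φ (Subtype.ext (hE.star_eq i j))

/-- Normal unital homomorphisms preserve totality of systems of matrix units. -/
theorem IsMatrixUnits.isTotal_map {M : VonNeumannAlgebra H}
    (φ : M.toStarSubalgebra →⋆ₐ[ℂ] (H →L[ℂ] H)) (hφ : IsNormalMap M φ)
    {E : ι → ι → M.toStarSubalgebra}
    (hE : IsMatrixUnits fun i j => (E i j : H →L[ℂ] H))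
    (ht : IsTotal fun i j => (E i j : H →L[ℂ] H)) : IsTotal fun i j => φ (E i j) := by
  intro ψ hψ
  rcases isEmpty_or_nonempty ι with hι | ⟨⟨o⟩⟩
  · exact ht ψ fun i => hι.elim i
  obtain ⟨a, b, ha, hb, hab⟩ := hφ ψ ψ
  have hsum : Summable fun n => ‖a n‖ * ‖b n‖ := by
    refine Summable.of_nonneg_of_le (fun n => by positivity) (fun n => ?_) (ha.add hb)
    nlinarith [sq_nonneg (‖a n‖ - ‖b n‖), sq_nonneg ‖a n‖, sq_nonneg ‖b n‖]
  -- Interchanges the sum over `i` with the series representing the normal functional `⟪ψ, φ(·) ψ⟫`;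
  -- Cauchy–Schwarz and Bessel dominate by `‖a n‖ * ‖b n‖`. The finite partial sums are all zero,
  -- whereas the limit is the value at `1`, namely `⟪ψ, ψ⟫`.
  have hlim := tendsto_tsum_of_dominated_convergence (𝓕 := Filter.atTop (α := Finset ι))
    (f := fun s n => ∑ i ∈ s, ⟪a n, (E i i : H →L[ℂ] H) (b n)⟫_ℂ)
    (g := fun n => ⟪a n, b n⟫_ℂ) hsum (fun n => hE.hasSum_inner ht o (a n) (b n))
    (Filter.Eventually.of_forall fun s n => by
      have h1 : ∑ i ∈ s, ⟪a n, (E i i : H →L[ℂ] H) (b n)⟫_ℂ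
          = ∑ i ∈ s, ⟪(E o i : H →L[ℂ] H) (a n), (E o i : H →L[ℂ] H) (b n)⟫_ℂ := by
        refine Finset.sum_congr rfl fun i _ => ?_
        rw [← hE.mul_same i o i, ← hE.star_eq o i, mul_apply_eq_comp,
          ContinuousLinearMap.star_eq_adjoint, ContinuousLinearMap.adjoint_inner_right]
      rw [h1]
      refine (norm_sum_le _ _).trans ?_
      refine (Finset.sum_le_sum fun i _ => norm_inner_le_norm _ _).trans ?_
      refine (Real.sum_mul_le_sqrt_mul_sqrt _ _ _).trans ?_
      gcongr
      · exact Real.sqrt_le_iff.2 ⟨norm_nonneg _, hE.sum_norm_sq_le o _ _⟩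
      · exact Real.sqrt_le_iff.2 ⟨norm_nonneg _, hE.sum_norm_sq_le o _ _⟩)
  have hz : ∀ s : Finset ι, ∑' n, ∑ i ∈ s, ⟪a n, (E i i : H →L[ℂ] H) (b n)⟫_ℂ = 0 := by
    intro s
    have := hasSum_sum (s := s) fun i _ => hab (E i i)
    rw [this.tsum_eq]
    refine Finset.sum_eq_zero fun i _ => ?_
    rw [hψ i, inner_zero_right]
  simp only [hz] at hlim
  have h1 := hab 1
  simp only [map_one, OneMemClass.coe_one, one_apply_eq_self] at h1
  rw [h1.tsum_eq] at hlim
  exact inner_self_eq_zero.1 (tendsto_nhds_unique hlim tendsto_const_nhds)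

/-- A σ-weakly continuous functional which vanishes on a unital *-algebra of operators vanishes on
its double commutant. -/
theorem tsum_inner_eq_zero_of_mem_generatedVN (A : StarSubalgebra ℂ (H →L[ℂ] H))
    (a b : lp (fun _ : ℕ => H) 2) (h : ∀ x ∈ A, ∑' n, ⟪a n, x (b n)⟫_ℂ = 0)
    {x : H →L[ℂ] H} (hx : x ∈ generatedVN (A : Set (H →L[ℂ] H))) :
    ∑' n, ⟪a n, x (b n)⟫_ℂ = 0 := by
  -- The amplification `1 ⊗ x` on `ℓ²(ℕ, H)` turns the functional into a single matrix coefficient.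
  -- As in the bicommutant theorem, the projection `P` onto the closure of `D(A) b` commutes with
  -- `D(A)`.
  let D : (H →L[ℂ] H) → (lp (fun _ : ℕ => H) 2 →L[ℂ] lp (fun _ : ℕ => H) 2) := fun x =>
    lp.mapCLM 2 (fun _ => x) (norm_nonneg x) (fun _ => le_rfl)
  have hD : ∀ x f n, D x f n = x (f n) := fun x f n => rfl
  have hDmul : ∀ x y f, D x (D y f) = D (x * y) f := fun x y f => by
    ext n; rfl
  have hDinner : ∀ x f g, ⟪D (star x) f, g⟫_ℂ = ⟪f, D x g⟫_ℂ := by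
    intro x f g
    simp only [lp.inner_eq_tsum, hD, ContinuousLinearMap.star_eq_adjoint,
      ContinuousLinearMap.adjoint_inner_left]
  let K₀ : Submodule ℂ (lp (fun _ : ℕ => H) 2) :=
    { carrier := {f | ∃ x ∈ A, f = D x b}
      add_mem' := by
        rintro _ _ ⟨x, hx, rfl⟩ ⟨y, hy, rfl⟩
        exact ⟨x + y, add_mem hx hy, by ext n; rfl⟩
      zero_mem' := ⟨0, zero_mem A, by ext n; rfl⟩
      smul_mem' := by
        rintro c _ ⟨x, hx, rfl⟩
        exact ⟨c • x, A.smul_mem hx c, by ext n; rfl⟩ }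
  let K := K₀.topologicalClosure
  have hKinv : ∀ x ∈ A, ∀ f ∈ K, D x f ∈ K := by
    intro x hx f hf
    refine map_mem_closure (D x).continuous hf ?_
    rintro _ ⟨y, hy, rfl⟩
    exact ⟨x * y, mul_mem hx hy, hDmul x y b⟩
  have : CompleteSpace K := K₀.isClosed_topologicalClosure.completeSpace_coe
  let P := K.starProjection
  have hDstar : ∀ x, star (D x) = D (star x) := by
    intro x
    rw [ContinuousLinearMap.star_eq_adjoint, eq_comm, ContinuousLinearMap.eq_adjoint_iff]
    exact hDinner x
  have hPD : ∀ x ∈ A, ∀ f, P (D x f) = D x (P f) := fun x hx f =>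
    starProjection_apply_comm (hKinv x hx) (hDstar x ▸ hKinv _ (star_mem hx)) f
  let J : ℕ → (H →L[ℂ] lp (fun _ : ℕ => H) 2) := fun n =>
    lp.singleContinuousLinearMap ℂ (fun _ : ℕ => H) 2 n
  have hDJ : ∀ x n ψ, D x (J n ψ) = J n (x ψ) := by
    intro x n ψ
    ext m
    rw [hD]
    simp only [J, lp.singleContinuousLinearMap_apply, lp.single_apply]
    by_cases hm : m = n
    · subst hm; simp
    · simp [hm]
  -- The matrix entries of `P` lie in `A'`, so `x ∈ A''` commutes with each of them and `D x`
  -- commutes with `P`.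
  let Q : ℕ → ℕ → (H →L[ℂ] H) := fun m n => lp.evalCLM ℂ (fun _ : ℕ => H) 2 m ∘L P ∘L J n
  have hQ : ∀ m n ψ, Q m n ψ = P (J n ψ) m := fun m n ψ => rfl
  have hQA : ∀ m n, ∀ y ∈ A, y * Q m n = Q m n * y := by
    intro m n y hy
    ext ψ
    change y (Q m n ψ) = Q m n (y ψ)
    rw [hQ, hQ, ← hDJ, hPD y hy, hD]
  have hPx : ∀ f, P (D x f) = D x (P f) := by
    have : P ∘L D x = D x ∘L P := by
      refine lp.ext_continuousLinearMap (by norm_num) fun n => ?_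
      ext ψ m
      change P (D x (J n ψ)) m = D x (P (J n ψ)) m
      rw [hDJ, hD, ← hQ, ← hQ]
      have := mem_generatedVN.1 hx (Q m n) fun g hg =>
        ⟨hQA m n g hg, hQA m n _ (star_mem (show g ∈ A from hg))⟩
      exact DFunLike.congr_fun this ψ
    exact fun f => DFunLike.congr_fun this f
  have hb : P b = b := K.starProjection_eq_self_iff.2
    (K₀.le_topologicalClosure ⟨1, one_mem A, by ext n; rfl⟩)
  have hmem : D x b ∈ K := by
    rw [← hb, ← hPx]
    exact K.starProjection_apply_mem _
  have ha : a ∈ Kᗮ := by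
    rw [Submodule.orthogonal_closure, Submodule.mem_orthogonal']
    rintro _ ⟨y, hy, rfl⟩
    rw [lp.inner_eq_tsum]
    exact h y hy
  have := (Submodule.mem_orthogonal' _ _).1 ha _ hmem
  rwa [lp.inner_eq_tsum] at this

end Normal

/-! ### Type I subfactors and the construction of the intertwiner. -/

section TypeI

variable {H : Type u} [NormedAddCommGroup H] [InnerProductSpace ℂ H] [CompleteSpace H]

/-- A Type I factor contains a total system of minimal matrix units. -/
theorem IsTypeIFactor.exists_matrixUnits [Nontrivial H] {N : VonNeumannAlgebra H}
    (hN : IsTypeIFactor N) :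
    ∃ (ι : Type u) (_ : Nonempty ι) (E : ι → ι → (H →L[ℂ] H)), (∀ i j, E i j ∈ N) ∧
      IsMatrixUnits E ∧ IsTotal E ∧
      ∀ x ∈ N, ∀ i j k l, ∃ c : ℂ, E i j * x * E k l = c • E i l := by
  obtain ⟨K, _, _, _, ⟨Φ⟩⟩ := hN
  obtain ⟨s, b, -⟩ := exists_hilbertBasis ℂ K
  have hb : Orthonormal ℂ b := b.orthonormal
  let e : s → s → (K →L[ℂ] K) := fun i j => InnerProductSpace.rankOne ℂ (b i) (b j)
  let E : s → s → (H →L[ℂ] H) := fun i j => (Φ.symm (e i j) : H →L[ℂ] H)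
  have hcompr : ∀ (x : K →L[ℂ] K) i j k l,
      e i j * x * e k l = ⟪b j, x (b k)⟫_ℂ • e i l := by
    intro x i j k l
    ext ψ
    simp [e, smul_smul, mul_comm]
  have hE : ∀ (x : N.toStarSubalgebra) i j k l,
      E i j * x * E k l = ⟪b j, Φ x (b k)⟫_ℂ • E i l := by
    intro x i j k l
    have := congrArg Φ.symm (hcompr (Φ x) i j k l)
    rw [map_mul, map_mul, StarAlgEquiv.symm_apply_apply, map_smul] at this
    exact congrArg Subtype.val this
  have hEN : ∀ i j, E i j ∈ N := fun i j => (Φ.symm (e i j)).2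
  have hmul : ∀ i j k l, E i j * E k l = ⟪b j, b k⟫_ℂ • E i l := by
    intro i j k l
    have := hE 1 i j k l
    rwa [map_one, OneMemClass.coe_one, mul_one, one_apply_eq_self] at this
  have hEmu : IsMatrixUnits E := by
    refine ⟨fun i j k => ?_, fun i j k l h => ?_, fun i j => ?_⟩
    · rw [hmul, inner_self_eq_norm_sq_to_K, hb.1 j]
      simp
    · rw [hmul, hb.2 h, zero_smul]
    · have : star (e i j) = e j i := by
        rw [ContinuousLinearMap.star_eq_adjoint]
        exact InnerProductSpace.adjoint_rankOne _ _
      have h2 := congrArg Φ.symm this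
      rw [map_star] at h2
      exact congrArg Subtype.val h2
  have hEt : IsTotal E := by
    -- The isomorphism `Φ` is only algebraic, so totality on `H` needs an argument. The common
    -- kernel is invariant under `N'`, hence its projection is in `N`; the image under `Φ` has all
    -- Hilbert basis coordinates zero, so the projection vanishes.
    let U : Submodule ℂ H := ⨅ i, LinearMap.ker (E i i).toLinearMap
    have hU : ∀ ψ, ψ ∈ U ↔ ∀ i, E i i ψ = 0 := by
      intro ψ
      simp [U, Submodule.mem_iInf]
    have hUc : IsClosed (U : Set H) := by
      rw [Submodule.coe_iInf]
      exact isClosed_iInter fun i => (E i i).isClosed_ker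
    have : CompleteSpace U := hUc.completeSpace_coe
    have hinv : ∀ y ∈ N.commutant, ∀ ψ ∈ U, y ψ ∈ U := by
      intro y hy ψ hψ
      rw [hU] at hψ ⊢
      intro i
      rw [← mul_apply_eq_comp, VonNeumannAlgebra.mem_commutant_iff.1 hy _ (hEN i i),
        mul_apply_eq_comp, hψ i, map_zero]
    have hP : U.starProjection ∈ N := by
      rw [← N.commutant_commutant, VonNeumannAlgebra.mem_commutant_iff]
      intro y hy
      ext ψ
      exact (starProjection_apply_comm (hinv y hy) (hinv _ (star_mem hy)) ψ).symm
    have hEP : ∀ i, E i i * U.starProjection = 0 := by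
      intro i
      ext ψ
      exact (hU _).1 (U.starProjection_apply_mem ψ) i
    have hΦP : Φ ⟨U.starProjection, hP⟩ = 0 := by
      ext ψ
      rw [zero_apply]
      refine b.repr.injective (lp.ext (funext fun i => ?_))
      have h1 : Φ.symm (e i i) * ⟨U.starProjection, hP⟩ = 0 := Subtype.ext (hEP i)
      have h2 := congrArg Φ h1
      rw [map_mul, StarAlgEquiv.apply_symm_apply, map_zero] at h2
      have h3 := congrArg (fun T => ⟪b i, T ψ⟫_ℂ) h2
      simp only [mul_apply_eq_comp, e, InnerProductSpace.rankOne_apply, inner_smul_right,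
        inner_self_eq_norm_sq_to_K, hb.1 i, zero_apply, inner_zero_right] at h3
      rw [b.repr_apply_apply, map_zero]
      simpa using h3
    have hP0 : U.starProjection = 0 := by
      rw [← map_zero Φ] at hΦP
      exact congrArg Subtype.val (Φ.injective hΦP)
    intro ψ hψ
    have := U.starProjection_eq_self_iff.2 ((hU ψ).2 hψ)
    rw [hP0] at this
    simpa using this.symm
  refine ⟨s, ?_, E, hEN, hEmu, hEt, fun x hx i j k l => ⟨_, hE ⟨x, hx⟩ i j k l⟩⟩
  by_contra hs
  rw [not_nonempty_iff] at hs
  obtain ⟨ψ, hψ⟩ := exists_ne (0 : H)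
  exact hψ (hEt ψ fun i => hs.elim i)

/-- A normal endomorphism of a von Neumann algebra `R` which is trivial on the relative commutant of
a Type I subfactor `N` is intertwined with the identity by a nonzero operator. -/
theorem exists_intertwiner_of_trivial_on_relative_commutant [Nontrivial H]
    {N R : VonNeumannAlgebra H} (hN : IsTypeIFactor N) (hNR : N ≤ R)
    (φ : R.toStarSubalgebra →⋆ₐ[ℂ] R.toStarSubalgebra)
    (hφ : IsNormalMap R fun x => (φ x : H →L[ℂ] H))
    (htriv : ∀ x : R.toStarSubalgebra, (x : H →L[ℂ] H) ∈ N.commutant → φ x = x) :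
    ∃ V : H →L[ℂ] H, V ≠ 0 ∧
      (∀ x : R.toStarSubalgebra, (φ x : H →L[ℂ] H) * V = V * (x : H →L[ℂ] H)) ∧
      ∀ y ∈ R.commutant, y * V = V * y := by
  obtain ⟨ι, ⟨o⟩, E, hEN, hE, hEt, hEmin⟩ := hN.exists_matrixUnits
  let E' : ι → ι → R.toStarSubalgebra := fun i j => ⟨E i j, hNR (hEN i j)⟩
  let φ' : R.toStarSubalgebra →⋆ₐ[ℂ] (H →L[ℂ] H) := R.toStarSubalgebra.subtype.comp φ
  have hF : IsMatrixUnits fun i j => φ' (E' i j) := IsMatrixUnits.map φ' (E := E') hE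
  have hFt : IsTotal fun i j => φ' (E' i j) := IsMatrixUnits.isTotal_map φ' hφ (E := E') hE hEt
  set F : ι → ι → (H →L[ℂ] H) := fun i j => φ' (E' i j) with hFdef
  have hFR : ∀ i j, F i j ∈ R := fun i j => (φ (E' i j)).2
  -- a nonzero operator from the range of `E o o` to that of `F o o`
  obtain ⟨i, hi⟩ : ∃ i, F o o * E i o ≠ 0 := by
    -- Otherwise `F o o = 0` by totality of `E`, and then every `F j j` vanishes, against totality
    -- of `F`.
    by_contra! h
    have h0 : F o o = 0 := hE.eq_of_forall_mul_right hEt o fun i => by rw [h i, zero_mul]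
    obtain ⟨ψ, hψ⟩ := exists_ne (0 : H)
    refine hψ (hFt ψ fun j => ?_)
    rw [← hF.mul_same j o j, ← hF.mul_same j o o]
    rw [h0]
    simp
  obtain ⟨w, hw⟩ : ∃ w, w = F o o * E i o := ⟨_, rfl⟩
  rw [← hw] at hi
  have hFw : F o o * w = w := by rw [hw, ← mul_assoc, hF.mul_same]
  have hwE : w * E o o = w := by rw [hw, mul_assoc, hE.mul_same]
  have hwcomm : ∀ x : R.toStarSubalgebra, (x : H →L[ℂ] H) ∈ N.commutant →
      (x : H →L[ℂ] H) * w = w * (x : H →L[ℂ] H) := by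
    intro x hx
    have h1 : ∀ j k, E j k * (x : H →L[ℂ] H) = (x : H →L[ℂ] H) * E j k := fun j k =>
      VonNeumannAlgebra.mem_commutant_iff.1 hx _ (hEN j k)
    -- Apply `φ`, which fixes `x`, to the relation `E o o * x = x * E o o`.
    have h2 : F o o * (x : H →L[ℂ] H) = (x : H →L[ℂ] H) * F o o := by
      have h3 : E' o o * x = x * E' o o := Subtype.ext (h1 o o)
      have h4 := congrArg (fun z => (φ z : H →L[ℂ] H)) h3
      simp only [map_mul, htriv x hx] at h4
      exact h4
    rw [hw, ← mul_assoc, ← h2, mul_assoc, mul_assoc, h1]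
  -- operators in the corner of `R` are intertwined by `w`
  have hcorner : ∀ y : R.toStarSubalgebra, E o o * (y : H →L[ℂ] H) = y →
      (y : H →L[ℂ] H) * E o o = y → (φ y : H →L[ℂ] H) * w = w * (y : H →L[ℂ] H) := by
    intro y hy hy'
    -- Taking both systems equal to `E` spreads `y` along the diagonal as `x = ∑ E j o * y * E o j`.
    -- This `x` lies in `N' ∩ R` and `y = E o o * x`, so the corner of `R` is `E o o * (N' ∩ R)`,
    -- where `φ` is known.
    obtain ⟨x, hx⟩ := hE.exists_intertwiner hE o hy
    have hxE := hE.intertwiner_mul hEt hE hy hy' hx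
    have hxR : x ∈ R := by
      rw [← R.commutant_commutant, VonNeumannAlgebra.mem_commutant_iff]
      intro z hz
      have hz' := fun g hg => VonNeumannAlgebra.mem_commutant_iff.1 hz g hg
      refine hE.eq_of_forall_mul hEt o fun j => ?_
      rw [← mul_assoc, ← mul_assoc, hz' _ (hNR (hEN o j)), mul_assoc, hx, ← mul_assoc,
        ← hz' _ y.2, mul_assoc, mul_assoc, hz' _ (hNR (hEN o j))]
    have hxN : x ∈ N.commutant := by
      rw [VonNeumannAlgebra.mem_commutant_iff]
      intro z hz
      refine hE.eq_of_forall_mul hEt o fun j => hE.eq_of_forall_mul_right hEt o fun k => ?_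
      -- Minimality: the entries of `z ∈ N` are multiples of `E o o`, which commutes with `y`.
      obtain ⟨c, hc⟩ := hEmin z hz o j k o
      calc E o j * (z * x) * E k o = (E o j * z) * (x * E k o) := by simp only [mul_assoc]
        _ = (E o j * z * E k o) * y := by rw [hxE]; simp only [mul_assoc]
        _ = y * (E o j * z * E k o) := by rw [hc, smul_mul_assoc, mul_smul_comm, hy, hy']
        _ = (y * E o j) * (z * E k o) := by simp only [mul_assoc]
        _ = E o j * (x * z) * E k o := by rw [← hx]; simp only [mul_assoc]
    let x' : R.toStarSubalgebra := ⟨x, hxR⟩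
    have hyx : y = E' o o * x' := Subtype.ext (by
      change (y : H →L[ℂ] H) = E o o * x
      rw [hx, hy'])
    have hφy : (φ y : H →L[ℂ] H) = F o o * x := by
      rw [hyx, map_mul, htriv x' hxN]
      rfl
    rw [hφy, mul_assoc, hwcomm x' hxN, ← mul_assoc, hFw]
    change w * x = _
    rw [hyx]
    change w * x = w * (E o o * x)
    rw [← mul_assoc, hwE]
  obtain ⟨V, hV⟩ := hF.exists_intertwiner hE o hFw
  have hVE := hF.intertwiner_mul hFt hE hFw hwE hV
  refine ⟨V, ?_, fun x => ?_, fun y hy => ?_⟩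
  · rintro rfl
    apply hi
    rw [← hwE, ← hV, mul_zero]
  · refine hF.eq_of_forall_mul hFt o fun j => hE.eq_of_forall_mul_right hEt o fun k => ?_
    -- Each matrix entry of `x` is in the corner, so its intertwining by `w` is the corresponding
    -- entry of the intertwining by `V`.
    have h1 := hcorner (E' o j * x * E' k o)
      (by
        change E o o * (E o j * (x : H →L[ℂ] H) * E k o) = E o j * (x : H →L[ℂ] H) * E k o
        rw [← mul_assoc, ← mul_assoc, hE.mul_same])
      (by
        change E o j * (x : H →L[ℂ] H) * E k o * E o o = E o j * (x : H →L[ℂ] H) * E k o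
        rw [mul_assoc, hE.mul_same])
    have h2 : (φ (E' o j * x * E' k o) : H →L[ℂ] H) = F o j * (φ x : H →L[ℂ] H) * F k o := by
      rw [map_mul, map_mul]
      rfl
    rw [h2] at h1
    calc F o j * ((φ x : H →L[ℂ] H) * V) * E k o
        = F o j * (φ x : H →L[ℂ] H) * (V * E k o) := by simp only [mul_assoc]
      _ = w * (E o j * (x : H →L[ℂ] H) * E k o) := by rw [hVE, ← mul_assoc]; exact h1
      _ = F o j * (V * (x : H →L[ℂ] H)) * E k o := by
        rw [← mul_assoc, ← mul_assoc, ← hV]; simp only [mul_assoc]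
  · have hy' := fun g hg => VonNeumannAlgebra.mem_commutant_iff.1 hy g hg
    have hyw : w * y = y * w := by
      rw [hw, mul_assoc, hy' _ (hNR (hEN i o)), ← mul_assoc, hy' _ (hFR o o), mul_assoc]
    refine hF.eq_of_forall_mul hFt o fun j => ?_
    calc F o j * (y * V) = y * (F o j * V) := by rw [← mul_assoc, hy' _ (hFR o j), mul_assoc]
      _ = w * y * E o j := by rw [hV, hyw, mul_assoc]
      _ = F o j * V * y := by rw [hV, mul_assoc, mul_assoc, hy' _ (hNR (hEN o j))]
      _ = F o j * (V * y) := mul_assoc _ _ _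

end TypeI

/-! ### From cone algebras to the quasi-local algebra, and the unitary in `R(Λ₁)`. -/

section Regions

variable {H : Type u} [NormedAddCommGroup H] [InnerProductSpace ℂ H] [CompleteSpace H] {d : ℕ}

theorem matrixUnit_mem_localAlgebra {S : Set Bond} {b : Bond} (hb : b ∈ S) (i j : Fin d) :
    matrixUnit b i j ∈ localAlgebra d S :=
  StarSubalgebra.le_topologicalClosure _ (StarAlgebra.subset_adjoin ℂ _ ⟨b, hb, i, j, rfl⟩)

theorem continuous_rep (π : QuasiLocal d →⋆ₐ[ℂ] (H →L[ℂ] H)) : Continuous π := by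
  have : IsClosed (localAlgebra d Set.univ : Set (ConfigSpace d →L[ℂ] ConfigSpace d)) :=
    StarSubalgebra.isClosed_topologicalClosure _
  let _ : CStarAlgebra (QuasiLocal d) := StarSubalgebra.cstarAlgebra (localAlgebra d Set.univ)
  exact AddMonoidHomClass.continuous_of_bound π 1 fun a => by
    rw [one_mul]
    exact NonUnitalStarAlgHom.norm_apply_le π a

/-- An operator which intertwines two representations on the observables at each bond
intertwines them. -/
theorem intertwines_of_forall_matrixUnit {π ρ : QuasiLocal d →⋆ₐ[ℂ] (H →L[ℂ] H)}
    {V : H →L[ℂ] H}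
    (h : ∀ b i j, ∀ a : QuasiLocal d, (a : ConfigSpace d →L[ℂ] ConfigSpace d) = matrixUnit b i j →
      ρ a * V = V * π a) (a : QuasiLocal d) : ρ a * V = V * π a := by
  have hclosed : IsClosed {a : QuasiLocal d | ρ a * V = V * π a} :=
    isClosed_eq ((continuous_rep ρ).mul continuous_const) (continuous_const.mul (continuous_rep π))
  set s : Set (ConfigSpace d →L[ℂ] ConfigSpace d) :=
    {E | ∃ b ∈ (Set.univ : Set Bond), ∃ i j : Fin d, E = matrixUnit b i j} with hs
  have hle : StarAlgebra.adjoin ℂ s ≤ localAlgebra d Set.univ :=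
    StarSubalgebra.le_topologicalClosure _
  -- The relation for `star x` is carried along because intertwining is not preserved by adjoints;
  -- the generators are closed under `star`.
  have key : ∀ x (hx : x ∈ StarAlgebra.adjoin ℂ s),
      ρ ⟨x, hle hx⟩ * V = V * π ⟨x, hle hx⟩ ∧
        ρ (star ⟨x, hle hx⟩) * V = V * π (star ⟨x, hle hx⟩) := by
    intro x hx
    induction hx using StarAlgebra.adjoin_induction with
    | mem x hx =>
      obtain ⟨b, -, i, j, rfl⟩ := hx
      exact ⟨h b i j _ rfl, h b j i _ (star_matrixUnit b i j)⟩
    | algebraMap r =>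
      have h1 : ∀ r : ℂ, ρ (algebraMap ℂ _ r) * V = V * π (algebraMap ℂ _ r) := by
        intro r
        simp only [AlgHomClass.commutes]
        exact Algebra.commutes r V
      refine ⟨h1 r, ?_⟩
      have h2 := h1 (star r)
      rwa [algebraMap_star_comm] at h2
    | add x y hx hy ihx ihy =>
      have h1 : (⟨x + y, hle (add_mem hx hy)⟩ : QuasiLocal d) = ⟨x, hle hx⟩ + ⟨y, hle hy⟩ := rfl
      simp only [h1, star_add, map_add, add_mul, mul_add, ihx.1, ihx.2, ihy.1, ihy.2, and_self]
    | mul x y hx hy ihx ihy =>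
      have h1 : (⟨x * y, hle (mul_mem hx hy)⟩ : QuasiLocal d) = ⟨x, hle hx⟩ * ⟨y, hle hy⟩ := rfl
      simp only [h1, star_mul, map_mul]
      constructor
      · rw [mul_assoc, ihy.1, ← mul_assoc, ihx.1, mul_assoc]
      · rw [mul_assoc, ihx.2, ← mul_assoc, ihy.2, mul_assoc]
    | star x hx ihx =>
      have h1 : (⟨star x, hle (star_mem hx)⟩ : QuasiLocal d) = star ⟨x, hle hx⟩ := rfl
      rw [h1, star_star]
      exact ihx.symm
  have hdense : DenseRange (StarSubalgebra.inclusion hle) := by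
    intro a
    rw [mem_closure_iff_seq_limit]
    have ha : (a : ConfigSpace d →L[ℂ] ConfigSpace d) ∈
        closure (StarAlgebra.adjoin ℂ s : Set (ConfigSpace d →L[ℂ] ConfigSpace d)) := a.2
    obtain ⟨x, hx, hlim⟩ := mem_closure_iff_seq_limit.1 ha
    exact ⟨fun n => ⟨x n, hle (hx n)⟩, fun n => ⟨⟨x n, hx n⟩, rfl⟩, tendsto_subtype_rng.2 hlim⟩
  exact hdense.induction_on a hclosed fun x => (key x x.2).1

theorem rep_mem_regionVN (π₀ : QuasiLocal d →⋆ₐ[ℂ] (H →L[ℂ] H)) {S : Set Bond} {a : QuasiLocal d}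
    (ha : a ∈ observables d S) : π₀ a ∈ regionVN π₀ S :=
  mem_generatedVN.2 fun _ hy => ((hy _ ⟨a, ha, rfl⟩).1).symm

theorem mem_commutant_regionVN_iff {π₀ : QuasiLocal d →⋆ₐ[ℂ] (H →L[ℂ] H)} {S : Set Bond}
    {x : H →L[ℂ] H} :
    x ∈ (regionVN π₀ S).commutant ↔ ∀ a ∈ observables d S, π₀ a * x = x * π₀ a := by
  rw [VonNeumannAlgebra.mem_commutant_iff]
  refine ⟨fun h a ha => h _ (rep_mem_regionVN π₀ ha), fun h g hg => ?_⟩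
  refine (mem_generatedVN.1 hg x ?_).symm
  rintro _ ⟨a, ha, rfl⟩
  refine ⟨h a ha, ?_⟩
  rw [← map_star]
  exact h _ (star_mem_observables ha)

theorem rep_mem_commutant_regionVN (π₀ : QuasiLocal d →⋆ₐ[ℂ] (H →L[ℂ] H)) {S : Set Bond}
    {a : QuasiLocal d} (ha : a ∈ observables d Sᶜ) : π₀ a ∈ (regionVN π₀ S).commutant := by
  refine mem_commutant_regionVN_iff.2 fun b hb => ?_
  rw [← map_mul, ← map_mul]
  exact congrArg π₀ (Subtype.ext (localAlgebra_commute disjoint_compl_right hb ha))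

/-- An intertwiner on the observables of a region intertwines the normal extension. -/
theorem IsNormalExtension.intertwines {π₀ ρ : QuasiLocal d →⋆ₐ[ℂ] (H →L[ℂ] H)} {S : Set Bond}
    {φ : (regionVN π₀ S).toStarSubalgebra →⋆ₐ[ℂ] (regionVN π₀ S).toStarSubalgebra}
    (hφ : IsNormalExtension π₀ ρ S φ) {V : H →L[ℂ] H}
    (hV : ∀ a ∈ observables d S, ρ a * V = V * π₀ a) (x : (regionVN π₀ S).toStarSubalgebra) :
    (φ x : H →L[ℂ] H) * V = V * (x : H →L[ℂ] H) := by
  ext ψ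
  refine ext_inner_left ℂ fun η => ?_
  rw [mul_apply_eq_comp, mul_apply_eq_comp, ← ContinuousLinearMap.adjoint_inner_left V,
    ← sub_eq_zero]
  obtain ⟨u, v, hu, hv, huv⟩ := hφ.normal η (V ψ)
  let A : StarSubalgebra ℂ (H →L[ℂ] H) :=
    ((localAlgebra d S).comap (localAlgebra d Set.univ).subtype).map π₀
  -- Prepending a term at index `0`, with the sign in `-ψ`, makes the difference of the two matrix
  -- coefficients one σ-weakly continuous functional. It vanishes on `π₀(𝔄(S))`, hence on the double
  -- commutant.
  let cons : H → (ℕ → H) → ℕ → H := fun z w n => Nat.casesOn n z w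
  have hcons : ∀ z w, (Summable fun n => ‖w n‖ ^ 2) → Memℓp (cons z w) 2 := by
    intro z w hw
    refine memℓp_gen ?_
    simp only [ENNReal.toReal_ofNat, Real.rpow_ofNat]
    exact (summable_nat_add_iff 1).1 hw
  let f : lp (fun _ : ℕ => H) 2 := ⟨_, hcons (ContinuousLinearMap.adjoint V η) u hu⟩
  let g : lp (fun _ : ℕ => H) 2 := ⟨_, hcons (-ψ) v hv⟩
  have hsum : ∀ y : (regionVN π₀ S).toStarSubalgebra,
      ∑' n, ⟪f n, (y : H →L[ℂ] H) (g n)⟫_ℂ = ⟪η, (φ y : H →L[ℂ] H) (V ψ)⟫_ℂ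
        - ⟪ContinuousLinearMap.adjoint V η, (y : H →L[ℂ] H) ψ⟫_ℂ := by
    intro y
    have h1 := (hasSum_nat_add_iff (f := fun n => ⟪f n, (y : H →L[ℂ] H) (g n)⟫_ℂ) 1).1 (huv y)
    rw [h1.tsum_eq, Finset.sum_range_one]
    change _ + ⟪ContinuousLinearMap.adjoint V η, (y : H →L[ℂ] H) (-ψ)⟫_ℂ = _
    rw [map_neg, inner_neg_right, sub_eq_add_neg]
  rw [← hsum x]
  refine tsum_inner_eq_zero_of_mem_generatedVN A f g ?_ x.2
  rintro _ ⟨a, ha, rfl⟩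
  have h1 := hsum ⟨π₀ a, rep_mem_regionVN π₀ ha⟩
  rw [hφ.map_eq a ha ⟨π₀ a, _⟩ rfl, ← mul_apply_eq_comp, hV a ha, mul_apply_eq_comp,
    ContinuousLinearMap.adjoint_inner_left, sub_self] at h1
  exact h1

/-- A multiple of an operator with scalar `V* V` and `V V*` is unitary. -/
theorem exists_smul_unitary [Nontrivial H] {V : H →L[ℂ] H} (hV0 : V ≠ 0) {c c' : ℂ}
    (h : star V * V = c • 1) (h' : V * star V = c' • 1) :
    ∃ t : ℂ, star (t • V) * (t • V) = 1 ∧ (t • V) * star (t • V) = 1 := by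
  have hc0 : c ≠ 0 := by
    rintro rfl
    rw [zero_smul, CStarRing.star_mul_self_eq_zero_iff] at h
    exact hV0 h
  have hcc : c = c' := by
    have h1 : c • V = c' • V := by
      calc c • V = V * (star V * V) := by rw [h, mul_smul_comm, mul_one]
        _ = c' • V := by rw [← mul_assoc, h', smul_mul_assoc, one_mul]
    exact smul_left_injective ℂ hV0 h1
  obtain ⟨ψ, hψ⟩ := exists_ne (0 : H)
  have hψ' : ‖ψ‖ ≠ 0 := norm_ne_zero_iff.2 hψ
  -- Evaluating `V* V = c` at `ψ` shows that `c` is this positive real, so `t = r^(-1/2)` normalises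
  -- `V`.
  set r : ℝ := ‖V ψ‖ ^ 2 / ‖ψ‖ ^ 2 with hr
  have hcr : c = (r : ℂ) := by
    have h1 := congrArg (fun T : H →L[ℂ] H => ⟪ψ, T ψ⟫_ℂ) h
    simp only [mul_apply_eq_comp, ContinuousLinearMap.star_eq_adjoint,
      ContinuousLinearMap.adjoint_inner_right, smul_apply, one_apply_eq_self,
      inner_smul_right, inner_self_eq_norm_sq_to_K] at h1
    rw [hr, Complex.ofReal_div, eq_div_iff (by exact_mod_cast pow_ne_zero 2 hψ')]
    push_cast
    exact h1.symm
  have hr0 : 0 < r := by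
    refine lt_of_le_of_ne (by positivity) fun h0 => hc0 ?_
    rw [hcr, ← h0, Complex.ofReal_zero]
  have hmul : star ((Real.sqrt r : ℂ)⁻¹) * ((Real.sqrt r : ℂ)⁻¹) * c = 1 := by
    have h1 : (Real.sqrt r : ℂ) * (Real.sqrt r : ℂ) = r := by
      exact_mod_cast Real.mul_self_sqrt hr0.le
    have h2 : star ((Real.sqrt r : ℂ)⁻¹) = (Real.sqrt r : ℂ)⁻¹ := by
      rw [star_inv₀]
      congr 1
      exact Complex.conj_ofReal _
    rw [h2, ← mul_inv, h1, hcr, inv_mul_cancel₀]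
    exact_mod_cast hr0.ne'
  refine ⟨(Real.sqrt r : ℂ)⁻¹, ?_, ?_⟩
  · rw [star_smul, smul_mul_smul_comm, h, smul_smul, hmul, one_smul]
  · rw [star_smul, smul_mul_smul_comm, h', ← hcc, smul_smul, mul_comm (_⁻¹) (star _), hmul,
      one_smul]

/-- An irreducible localised endomorphism which is trivial on a relative commutant
`R(Λ₁)' ∩ R(Λ₂)`, where the inclusion of cone algebras is split, is unitarily equivalent to the
identity, with a unitary in `R(Λ₁)`. -/
theorem isSumOfIdentities_of_actsTriviallyOnRelativeCommutant
    {π₀ ρ : QuasiLocal d →⋆ₐ[ℂ] (H →L[ℂ] H)} (hirr : IsIrreducibleRep π₀) (hHaag : HaagDuality π₀)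
    {Λ₁ Λ₂ : Cone} (hsub : Λ₁.bonds ⊆ Λ₂.bonds) {N : VonNeumannAlgebra H} (hN : IsTypeIFactor N)
    (hN₁ : regionVN π₀ Λ₁.bonds ≤ N) (hN₂ : N ≤ regionVN π₀ Λ₂.bonds)
    (hρ : IsLocalisedEndomorphism π₀ Λ₁ ρ) (hρirr : IsIrreducibleOn π₀ Λ₁ ρ)
    (htriv : ActsTriviallyOnRelativeCommutant π₀ Λ₁ Λ₂ ρ) : IsSumOfIdentities π₀ Λ₁ ρ := by
  obtain ⟨hnt, hirr⟩ := hirr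
  obtain ⟨φ, hφ⟩ := hρ.extends_to Λ₂ hsub
  obtain ⟨V, hV0, hVφ, hVcomm⟩ := exists_intertwiner_of_trivial_on_relative_commutant hN hN₂ φ
    hφ.normal fun x hx => htriv φ hφ x <| VonNeumannAlgebra.mem_commutant_iff.2 fun g hg =>
      VonNeumannAlgebra.mem_commutant_iff.1 hx g (hN₁ hg)
  have hV : ∀ a, ρ a * V = V * π₀ a := by
    refine intertwines_of_forall_matrixUnit fun b i j a ha => ?_
    -- A single bond is either in `Λ₂`, where `V` intertwines `φ`, or outside, where `ρ = π₀` and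
    -- `V` commutes with `R(Λ₂)'`.
    by_cases hb : b ∈ Λ₂.bonds
    · have ha' : a ∈ observables d Λ₂.bonds := by
        change (a : ConfigSpace d →L[ℂ] ConfigSpace d) ∈ localAlgebra d Λ₂.bonds
        rw [ha]
        exact matrixUnit_mem_localAlgebra hb i j
      rw [← hφ.map_eq a ha' ⟨π₀ a, rep_mem_regionVN π₀ ha'⟩ rfl]
      exact hVφ _
    · have ha' : a ∈ observables d Λ₂.bondsᶜ := by
        change (a : ConfigSpace d →L[ℂ] ConfigSpace d) ∈ localAlgebra d Λ₂.bondsᶜ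
        rw [ha]
        exact matrixUnit_mem_localAlgebra hb i j
      rw [hρ.localised a (localAlgebra_mono d (Set.compl_subset_compl.2 hsub) ha')]
      exact hVcomm _ (rep_mem_commutant_regionVN π₀ ha')
  have hVR : V ∈ regionVN π₀ Λ₁.bonds := by
    rw [hHaag Λ₁, mem_commutant_regionVN_iff]
    intro a ha
    rw [← hV a, hρ.localised a ha]
  have hV' : ∀ a, star V * ρ a = π₀ a * star V := by
    intro a
    have := congrArg star (hV (star a))
    simpa [← map_star] using this
  obtain ⟨c, hc⟩ := hirr (star V * V) fun a => by
    rw [mul_assoc, ← hV, ← mul_assoc, hV', mul_assoc]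
  obtain ⟨φ₁, hφ₁⟩ := hρ.extends_to Λ₁ subset_rfl
  -- Irreducibility of `ρ` concerns the extension to `R(Λ₁)`, so the intertwining has to be extended
  -- there before `V V*` is seen to commute with its range.
  have hVφ₁ := hφ₁.intertwines fun a _ => hV a
  obtain ⟨c', hc'⟩ := hρirr φ₁ hφ₁ (V * star V) (mul_mem hVR (star_mem hVR)) fun x => by
    have h1 := congrArg star (hVφ₁ (star x))
    simp only [map_star, star_mul, StarMemClass.coe_star, star_star] at h1
    rw [mul_assoc, h1, ← mul_assoc, ← hVφ₁, mul_assoc]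
  obtain ⟨t, ht, ht'⟩ := exists_smul_unitary hV0 hc hc'
  refine ⟨Unit, inferInstance, fun _ => t • V,
    fun _ => (regionVN π₀ Λ₁.bonds).toStarSubalgebra.smul_mem hVR t, fun _ => ht,
    fun i j hij => absurd (Subsingleton.elim i j) hij, fun ψ => ?_, fun a ψ => ?_⟩
  · convert hasSum_fintype (fun _ : Unit => ((t • V) * star (t • V)) ψ) using 1
    rw [Fintype.sum_unique, ht', one_apply_eq_self]
  · convert hasSum_fintype (fun _ : Unit => ((t • V) * π₀ a * star (t • V)) ψ) using 1
    rw [Fintype.sum_unique]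
    congr 1
    rw [smul_mul_assoc, ← hV, ← mul_smul_comm, mul_assoc, ht', mul_one]

end Regions

end SpinSystem

end

open SpinSystem in
theorem mainTheorem6 {d : ℕ} (hd : 0 < d)
    {H : Type*} [NormedAddCommGroup H] [InnerProductSpace ℂ H] [CompleteSpace H]
    (π₀ : QuasiLocal d →⋆ₐ[ℂ] (H →L[ℂ] H)) (hirr : IsIrreducibleRep π₀)
    (hHaag : HaagDuality π₀)
    (ll : Cone → Cone → Prop) (hsplit : IsDistalSplit π₀ ll) (hsep : SeparatesCones ll)
    (Λ₁ : Cone) (ρ : QuasiLocal d →⋆ₐ[ℂ] (H →L[ℂ] H))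
    (hρ : IsLocalisedEndomorphism π₀ Λ₁ ρ) (hρirr : IsIrreducibleOn π₀ Λ₁ ρ) :
    ((∀ Λ₂ : Cone, ll Λ₁ Λ₂ → ActsTriviallyOnRelativeCommutant π₀ Λ₁ Λ₂ ρ) →
      IsSumOfIdentities π₀ Λ₁ ρ) ∧
    ((∃ Λ₂ : Cone, ll Λ₁ Λ₂ ∧ Λ₁.angle < Λ₂.angle) →
      (∀ Λ₂ : Cone, ll Λ₁ Λ₂ → Λ₁.angle < Λ₂.angle →
        ActsTriviallyOnRelativeCommutant π₀ Λ₁ Λ₂ ρ) →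
      IsSumOfIdentities π₀ Λ₁ ρ) := by
  have main : ∀ Λ₂ : Cone, ll Λ₁ Λ₂ → ActsTriviallyOnRelativeCommutant π₀ Λ₁ Λ₂ ρ →
      IsSumOfIdentities π₀ Λ₁ ρ := by
    intro Λ₂ hll htriv
    obtain ⟨hsub, N, hN, hN₁, hN₂⟩ := hsplit Λ₁ Λ₂ hll
    exact isSumOfIdentities_of_actsTriviallyOnRelativeCommutant hirr hHaag hsub hN hN₁ hN₂ hρ
      hρirr htriv
  refine ⟨fun h => ?_, fun ⟨Λ₂, hll, hangle⟩ h => main Λ₂ hll (h Λ₂ hll hangle)⟩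
  -- Non-triviality of `ll` serves only to provide some cone `Λ₂` with `Λ₁ ≪ Λ₂`.
  obtain ⟨-, Λ₂, -, hll, -⟩ := hsep Λ₁
  exact main Λ₂ hll (h Λ₂ hll)
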